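/- Let $R$ be a commutative Noetherian ring, $S$ an $R$-algebra (not necessarily commutative) that is finitely generated as an $R$-module, and $M$ and $N$ finitely generated right $S$-modules. For a ring $A$ and right $A$-modules $P$ and $Q$, let $\operatorname{spl}_A(P,Q)\in\{0,1,2,\ldots\}\cup\{\infty\}$ denote the supremum of the nonnegative integers $t$ such that there exists a split surjective $A$-linear map $P\to Q^{\oplus t}$. Let $j\text{-}\operatorname{Spec}(R)$ be the set of all prime ideals of $R$ that can be expressed as intersections of maximal ideals of $R$. Let $X:=j\text{-}\operatorname{Spec}(R)\cap\operatorname{Supp}_R(N)$, with the subspace topology induced by the Zariski topology on $\operatorname{Spec}(R)$, and suppose that the Krull dimension of $X$ is not $\infty$ (where $\dim\varnothing=-\infty$). For $\mathfrak p\in X$, let $\dim_X(\mathfrak p)$ denote the Krull dimension of the subspace $\{\mathfrak q\in X:\mathfrak p\subseteq\mathfrak q\}$. Then $$\operatorname{spl}_S(M,N)\geq\inf\{\operatorname{spl}_{S_{\mathfrak p}}(M_{\mathfrak p},N_{\mathfrak p})-\dim_X(\mathfrak p):\mathfrak p\in X\},$$ where the infimum is taken in the extended real numbers (so that the infimum of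 the empty set is $\infty$). -/

import Mathlib

/-! Right modules over a ring `A` are modules over the opposite ring `Aᵐᵒᵖ`. -/

/-- The global splitting capacity `spl_A(M, N)` of a right `A`-module `M` with respect to a right
`A`-module `N`: the supremum in `ℕ ∪ {∞}` of the nonnegative integers `t` such that there is an
`A`-linear map `M → N^t` that has an `A`-linear right inverse. -/
noncomputable def splittingCapacity (A M N : Type*) [Ring A] [AddCommGroup M] [Module Aᵐᵒᵖ M]
    [AddCommGroup N] [Module Aᵐᵒᵖ N] : ℕ∞ :=
  sSup {k : ℕ∞ | ∃ t : ℕ, k = t ∧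
    ∃ (f : M →ₗ[Aᵐᵒᵖ] (Fin t → N)) (g : (Fin t → N) →ₗ[Aᵐᵒᵖ] M), f ∘ₗ g = LinearMap.id}

namespace LocalizedModule

variable {R A M : Type*} [CommRing R] [Ring A] [Algebra R A] [AddCommGroup M] [Module R M]
  [Module Aᵐᵒᵖ M] [IsScalarTower R Aᵐᵒᵖ M] {W : Submonoid R}

theorem op_smul_smul_comm (a : A) (r : R) (m : M) :
    MulOpposite.op a • r • m = r • MulOpposite.op a • m := by
  rw [← algebraMap_smul Aᵐᵒᵖ r m, ← algebraMap_smul Aᵐᵒᵖ r (MulOpposite.op a • m),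
    ← mul_smul, ← mul_smul, Algebra.commutes]

/-- The right action of a fraction `a / s` on a fraction `m / t`, with value `(m a) / (s t)`. -/
def rightSMul (x : LocalizedModule W A) (y : LocalizedModule W M) : LocalizedModule W M :=
  liftOn x (fun p => liftOn y (fun q => mk (MulOpposite.op p.1 • q.1) (p.2 * q.2)) (by
    rintro ⟨m, t⟩ ⟨m', t'⟩ ⟨v, e⟩
    rw [mk_eq]
    refine ⟨v, ?_⟩
    have h := congrArg (fun n => (p.2 : R) • MulOpposite.op p.1 • n) e
    simp only [Submonoid.smul_def, Submonoid.coe_mul, op_smul_smul_comm, smul_smul] at h ⊢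
    convert h using 2 <;> ring)) (by
    rintro ⟨a, s⟩ ⟨a', s'⟩ ⟨u, e⟩
    induction y using induction_on with
    | h m t =>
      rw [liftOn_mk, liftOn_mk, mk_eq]
      refine ⟨u, ?_⟩
      have h := congrArg (fun b => (t : R) • MulOpposite.op b • m) e
      simp only [Submonoid.smul_def, Submonoid.coe_mul, MulOpposite.op_smul, smul_assoc,
        smul_smul] at h ⊢
      convert h using 2 <;> ring)

theorem rightSMul_mk (a : A) (s : W) (m : M) (t : W) :
    rightSMul (mk a s) (mk m t) = mk (MulOpposite.op a • m) (s * t) := by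
  rw [rightSMul, liftOn_mk, liftOn_mk]

/-- If `M` is a right `A`-module, then its localization `W⁻¹M` is a right `W⁻¹A`-module. -/
instance instModuleMulOpposite : Module (LocalizedModule W A)ᵐᵒᵖ (LocalizedModule W M) where
  smul x y := rightSMul x.unop y
  one_smul y := by
    change rightSMul (1 : LocalizedModule W A) y = y
    induction y using induction_on with
    | h m t =>
      rw [show (1 : LocalizedModule W A) = mk 1 1 from OreLocalization.one_def, rightSMul_mk]
      simp
  mul_smul x y z := by
    change rightSMul (y.unop * x.unop) z = rightSMul x.unop (rightSMul y.unop z)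
    generalize x.unop = x
    generalize y.unop = y
    induction x, y using induction_on₂ with
    | _ a b s t =>
      induction z using induction_on with
      | h m v =>
        rw [mk_mul_mk, rightSMul_mk, rightSMul_mk, rightSMul_mk, MulOpposite.op_mul, mul_smul]
        congr 1
        rw [mul_assoc, mul_left_comm]
  smul_zero x := by
    change rightSMul x.unop 0 = 0
    generalize x.unop = x
    induction x using induction_on with
    | h a s => rw [← zero_mk 1, rightSMul_mk, smul_zero, zero_mk, zero_mk]
  smul_add x y z := by
    change rightSMul x.unop (y + z) = rightSMul x.unop y + rightSMul x.unop z
    generalize x.unop = x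
    induction x using induction_on with
    | h a s =>
      induction y, z using induction_on₂ with
      | _ m n t v =>
        rw [mk_add_mk, rightSMul_mk, rightSMul_mk, rightSMul_mk, mk_add_mk, mk_eq]
        refine ⟨1, ?_⟩
        simp only [one_smul, Submonoid.smul_def, Submonoid.coe_mul, smul_add,
          op_smul_smul_comm, smul_smul]
        congr 2 <;> ring
  add_smul x y z := by
    change rightSMul (x.unop + y.unop) z = rightSMul x.unop z + rightSMul y.unop z
    generalize x.unop = x
    generalize y.unop = y
    induction x, y using induction_on₂ with
    | _ a b s t =>
      induction z using induction_on with
      | h m v =>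
        rw [mk_add_mk, rightSMul_mk, rightSMul_mk, rightSMul_mk, mk_add_mk, mk_eq]
        refine ⟨1, ?_⟩
        simp only [one_smul, Submonoid.smul_def, Submonoid.coe_mul, MulOpposite.op_add,
          MulOpposite.op_smul, add_smul, smul_add, smul_assoc, smul_smul]
        congr 2 <;> ring
  zero_smul z := by
    change rightSMul (0 : LocalizedModule W A) z = 0
    induction z using induction_on with
    | h m v =>
      rw [← zero_mk (M := A) (1 : W), rightSMul_mk, MulOpposite.op_zero, zero_smul, zero_mk]

theorem op_mk_smul_mk (a : A) (s : W) (m : M) (t : W) :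
    MulOpposite.op (mk a s) • mk m t = mk (MulOpposite.op a • m) (s * t) :=
  rightSMul_mk a s m t

end LocalizedModule

/-- The local splitting capacity `spl_{S_p}(M_p, N_p)` at a prime `p` of `R`, where the
localizations are taken with respect to the multiplicative set `R ∖ p`. -/
noncomputable def localSplittingCapacity {R : Type*} [CommRing R] (S M N : Type*) [Ring S]
    [Algebra R S]
    [AddCommGroup M] [Module R M] [Module Sᵐᵒᵖ M] [IsScalarTower R Sᵐᵒᵖ M]
    [AddCommGroup N] [Module R N] [Module Sᵐᵒᵖ N] [IsScalarTower R Sᵐᵒᵖ N]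
    (p : PrimeSpectrum R) : ℕ∞ :=
  splittingCapacity (LocalizedModule p.asIdeal.primeCompl S)
    (LocalizedModule p.asIdeal.primeCompl M) (LocalizedModule p.asIdeal.primeCompl N)

/-- `j-Spec(R)`: the prime ideals of `R` that are intersections of maximal ideals of `R`. -/
def jSpec (R : Type*) [CommRing R] : Set (PrimeSpectrum R) :=
  {p | ∃ T : Set (Ideal R), (∀ m ∈ T, m.IsMaximal) ∧ p.asIdeal = sInf T}

/-- `dim_X(p)`: the Krull dimension of the subspace `Var(p) ∩ X` of `Spec(R)`, where `Var(p)` is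
the set of the primes that contain `p`. -/
noncomputable def dimAt {R : Type*} [CommRing R] (X : Set (PrimeSpectrum R))
    (p : PrimeSpectrum R) : WithBot ℕ∞ :=
  topologicalKrullDim ↥({q : PrimeSpectrum R | p.asIdeal ≤ q.asIdeal} ∩ X)

/-- The inclusion of `{-∞} ∪ ℕ ∪ {∞}`, where dimensions live, into the extended reals. -/
noncomputable def dimToEReal : WithBot ℕ∞ → EReal
  | ⊥ => ⊥
  | (n : ℕ∞) => ((n : ENNReal) : EReal)

/-! Put `E = End_S(N)`, a finite `R`-algebra, and let `g 1, ..., g n` generate `Hom_S(N, M)` over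
`R`. The tuples `(f ∘ g i)`, for `f : M → N`, form a left `E`-submodule `L` of `E ^ n`, and `N ^ t`
splits off from `M` as soon as some `E`-linear map `E ^ n → E ^ t` carries `L` onto `E ^ t`
(`exists_split_of_map_compTuples_eq_top`). Local splittings bound the rank of `L` from below, where
rank at `p` means the size of a free module inside the image of `L` over the semisimple quotient of
`κ(p) ⊗ E` (`hasFibreRank_compTuples`).

The map to `E ^ t` is a composite of shears `E ^ (n + 1) → E ^ n`, `x ↦ (x (j + 1) + x 0 * a j)`,
chosen so that the rank at every `p` in `X` stays at least `min n (t + d p)`, with `d` the dimension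
function. Any shear lowers the rank by at most one (`HasFibreRank.map_shear`), so only points
without a spare unit of rank matter. Ranks are lower semicontinuous, hence the points of `X` of rank
at most `k` form a closed set with finitely many generic points (`exists_finset_generic`), and one
`a` preserves the required ranks at all of these for all `k` (`exists_shear_forall_hasFibreRank`). A
nongeneric point always has rank to spare: a proper generization `q` of `p` has `d q > d p`, so its
rank was required to be larger. Once `n = t`, the rank is full at every maximal ideal in the support
of `E`, and Nakayama's lemma gives `L = E ^ t`. -/

/-! ### Cancellation and general position over semisimple rings -/

theorem exists_injective_of_simple_prod {A T X Y : Type*} [Ring A] [IsSemisimpleRing A]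
    [AddCommGroup T] [Module A T] [IsSimpleModule A T] [AddCommGroup X] [Module A X]
    [AddCommGroup Y] [Module A Y] (f : T × X →ₗ[A] T × Y) (hf : Function.Injective f) :
    ∃ g : X →ₗ[A] Y, Function.Injective g := by
  let h : X →ₗ[A] Y := LinearMap.snd A T Y ∘ₗ f ∘ₗ LinearMap.inr A T X
  let K := LinearMap.ker h
  let θ : K →ₗ[A] T := LinearMap.fst A T Y ∘ₗ f ∘ₗ LinearMap.inr A T X ∘ₗ K.subtype
  have hfK : ∀ k : K, f (0, (k : X)) = (θ k, 0) := fun k => Prod.ext rfl k.2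
  have hθ : Function.Injective θ := by
    rw [← LinearMap.ker_eq_bot, LinearMap.ker_eq_bot']
    intro k hk
    have h1 := hfK k
    rw [hk] at h1
    have h2 : ((0 : T), (k : X)) = 0 := hf (by rw [h1, map_zero]; rfl)
    exact Subtype.ext (congrArg Prod.snd h2)
  rcases eq_or_ne (LinearMap.range θ) ⊥ with hr | hr
  · refine ⟨h, ?_⟩
    rw [← LinearMap.ker_eq_bot, LinearMap.ker_eq_bot']
    intro x hx
    have h0 : θ ⟨x, hx⟩ = 0 := by
      have : θ ⟨x, hx⟩ ∈ LinearMap.range θ := ⟨_, rfl⟩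
      rwa [hr, Submodule.mem_bot] at this
    have := hθ (h0.trans (map_zero θ).symm)
    exact congrArg Subtype.val this
  -- Here `θ` identifies `K` with the simple module `T`, so the summand `K` of `X` can be fed into
  -- the `T` coordinate of the source, where it no longer lies in the kernel.
  · have hr' : LinearMap.range θ = ⊤ := (eq_bot_or_eq_top _).resolve_left hr
    obtain ⟨π, hπ⟩ := IsSemisimpleModule.extension_property K.subtype K.injective_subtype
      LinearMap.id
    have hπ' : ∀ k : K, π k = k := fun k => LinearMap.congr_fun hπ k
    let g : X →ₗ[A] Y := LinearMap.snd A T Y ∘ₗ f ∘ₗ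
      LinearMap.prod (θ ∘ₗ π) (LinearMap.id - K.subtype ∘ₗ π)
    refine ⟨g, ?_⟩
    rw [← LinearMap.ker_eq_bot, LinearMap.ker_eq_bot']
    intro x hx
    obtain ⟨k, hk⟩ : (f (θ (π x), x - π x)).1 ∈ LinearMap.range θ := hr' ▸ Submodule.mem_top
    have h1 : f (θ (π x), x - π x) = f (0, (k : X)) := by
      rw [hfK]
      exact Prod.ext hk.symm hx
    have h2 := hf h1
    have h3 : π x = 0 := hθ (by rw [map_zero]; exact congrArg Prod.fst h2)
    have h4 : x = k := by
      have := congrArg Prod.snd h2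
      simpa [h3] using this
    rw [h4, hπ'] at h3
    rw [h4, h3]; rfl

/-- `P` has finite length, so simple summands can be cancelled one at a time; the induction runs
over the submodules of `P`. -/
theorem exists_injective_of_prod {A P X Y : Type*} [Ring A] [IsSemisimpleRing A]
    [AddCommGroup P] [Module A P] [Module.Finite A P] [AddCommGroup X] [Module A X]
    [AddCommGroup Y] [Module A Y] (f : P × X →ₗ[A] P × Y) (hf : Function.Injective f) :
    ∃ g : X →ₗ[A] Y, Function.Injective g := by
  suffices H : ∀ (Q : Submodule A P) (f : Q × X →ₗ[A] Q × Y), Function.Injective f →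
      ∃ g : X →ₗ[A] Y, Function.Injective g by
    let e : (⊤ : Submodule A P) ≃ₗ[A] P := Submodule.topEquiv
    refine H ⊤ ((e.symm.prodCongr (LinearEquiv.refl A Y)).toLinearMap ∘ₗ f ∘ₗ
      (e.prodCongr (LinearEquiv.refl A X)).toLinearMap) ?_
    exact (e.symm.prodCongr (LinearEquiv.refl A Y)).injective.comp
      (hf.comp (e.prodCongr (LinearEquiv.refl A X)).injective)
  intro Q
  induction Q using WellFoundedLT.induction with
  | ind Q ih =>
    intro f hf
    rcases eq_or_ne Q ⊥ with rfl | hQ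
    · refine ⟨LinearMap.snd A _ Y ∘ₗ f ∘ₗ LinearMap.inr A _ X, ?_⟩
      intro x x' h
      have := hf (Prod.ext (Subsingleton.elim _ _) h : f (0, x) = f (0, x'))
      exact congrArg Prod.snd this
    · have : Nontrivial Q := Submodule.nontrivial_iff_ne_bot.2 hQ
      obtain ⟨T, hT⟩ := IsSemisimpleModule.exists_simple_submodule A Q
      obtain ⟨T', hT'⟩ := exists_isCompl T
      let e := Submodule.prodEquivOfIsCompl T T' hT'
      let Q' : Submodule A P := T'.map Q.subtype
      let e' : T' ≃ₗ[A] Q' := Submodule.equivMapOfInjective _ Q.injective_subtype T'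
      have hlt : Q' < Q := by
        refine lt_of_le_of_ne (Submodule.map_subtype_le _ _) fun h => ?_
        have h1 : T' = ⊤ := by
          apply Submodule.map_injective_of_injective Q.injective_subtype
          rw [Submodule.map_subtype_top]; exact h
        rw [h1] at hT'
        have h2 : T = ⊥ := by simpa using hT'.inf_eq_bot
        have := hT.nontrivial
        exact (Submodule.nontrivial_iff_ne_bot.1 this) h2
      let EX : (T × (Q' × X)) ≃ₗ[A] (Q × X) :=
        (LinearEquiv.prodAssoc A T Q' X).symm ≪≫ₗ
          ((LinearEquiv.refl A T).prodCongr e'.symm ≪≫ₗ e).prodCongr (LinearEquiv.refl A X)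
      let EY : (T × (Q' × Y)) ≃ₗ[A] (Q × Y) :=
        (LinearEquiv.prodAssoc A T Q' Y).symm ≪≫ₗ
          ((LinearEquiv.refl A T).prodCongr e'.symm ≪≫ₗ e).prodCongr (LinearEquiv.refl A Y)
      obtain ⟨g, hg⟩ := exists_injective_of_simple_prod
        (EY.symm.toLinearMap ∘ₗ f ∘ₗ EX.toLinearMap)
        (EY.symm.injective.comp (hf.comp EX.injective))
      exact ih Q' hlt g hg

theorem exists_injective_of_succ {A W : Type*} [Ring A] [IsSemisimpleRing A]
    [AddCommGroup W] [Module A W] {s : ℕ} (f : (Fin (s + 1) → A) →ₗ[A] A × W)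
    (hf : Function.Injective f) : ∃ g : (Fin s → A) →ₗ[A] W, Function.Injective g :=
  exists_injective_of_prod (f ∘ₗ (Fin.consLinearEquiv A (fun _ => A)).toLinearMap)
    (hf.comp (LinearEquiv.injective _))

/-- General position: an injection `(f, k) : P → F × A` can be sheared along a map `b : A → F` such
that the first component becomes injective, as soon as `P` embeds in `F`; all multiples of `b` by
units do as well. -/
theorem exists_shear_injective {A P F : Type*} [Ring A] [IsSemisimpleRing A]
    [AddCommGroup P] [Module A P] [Module.Finite A P] [AddCommGroup F] [Module A F]
    (f : P →ₗ[A] F) (k : P →ₗ[A] A) (hfk : Function.Injective (f.prod k))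
    (i : P →ₗ[A] F) (hi : Function.Injective i) :
    ∃ b : A →ₗ[A] F, ∀ c : A, IsUnit c →
      ∀ x, f x + c • b (k x) = 0 → x = 0 := by
  obtain ⟨K', hK'⟩ := exists_isCompl (LinearMap.ker f)
  obtain ⟨C, hC⟩ := exists_isCompl (LinearMap.range f)
  let eP := Submodule.prodEquivOfIsCompl _ _ hK'.symm
  let eF := Submodule.prodEquivOfIsCompl _ _ hC
  let e : K' ≃ₗ[A] LinearMap.range f :=
    LinearEquiv.ofBijective (f.rangeRestrict ∘ₗ K'.subtype) (by
      constructor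
      · rw [← LinearMap.ker_eq_bot, LinearMap.ker_eq_bot']
        intro x hx
        have h1 : (x : P) ∈ LinearMap.ker f := congrArg Subtype.val hx
        exact Subtype.ext (Submodule.disjoint_def.1 hK'.disjoint _ h1 x.2)
      · rintro ⟨_, y, rfl⟩
        obtain ⟨⟨u, v⟩, rfl⟩ := eP.surjective y
        refine ⟨u, Subtype.ext ?_⟩
        have := LinearMap.mem_ker.1 v.2
        simp [eP, this])
  -- Since `P = K' ⊕ ker f`, `F = range f ⊕ C` and `K' ≅ range f`, cancelling `K'` from the
  -- embedding `i` embeds `ker f` in `C`. On `ker f` the map `k` is injective, so it has a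
  -- retraction `ρ`. The shear `j ∘ ρ` thus repairs `f` exactly on its kernel, with values
  -- independent of `range f`.
  obtain ⟨j, hj⟩ := exists_injective_of_prod
    ((e.symm.prodCongr (LinearEquiv.refl A C)).toLinearMap ∘ₗ eF.symm.toLinearMap ∘ₗ i ∘ₗ
      eP.toLinearMap)
    ((e.symm.prodCongr (LinearEquiv.refl A C)).injective.comp (eF.symm.injective.comp (hi.comp eP.injective)))
  obtain ⟨ρ, hρ⟩ := IsSemisimpleModule.extension_property (k ∘ₗ (LinearMap.ker f).subtype) (by
    rw [← LinearMap.ker_eq_bot, LinearMap.ker_eq_bot']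
    intro x hx
    refine Subtype.ext (hfk ?_)
    rw [ZeroMemClass.coe_zero, map_zero]
    exact Prod.ext x.2 hx) LinearMap.id
  refine ⟨C.subtype ∘ₗ j ∘ₗ ρ, fun c hc x hx => ?_⟩
  have h1 : f x = 0 := by
    refine Submodule.disjoint_def.1 hC.disjoint _ ⟨x, rfl⟩ ?_
    rw [eq_neg_of_add_eq_zero_left hx]
    exact C.neg_mem (C.smul_mem _ (j _).2)
  have h2 : ρ (k x) = ⟨x, h1⟩ := LinearMap.congr_fun hρ (⟨x, h1⟩ : LinearMap.ker f)
  rw [h1, zero_add, LinearMap.comp_apply, LinearMap.comp_apply, h2, hc.smul_eq_zero] at hx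
  have h3 : j ⟨x, h1⟩ = 0 := Subtype.ext hx
  exact congrArg Subtype.val (hj (h3.trans (map_zero j).symm))

/-! ### Semisimple fibres and Nakayama's lemma -/

open scoped TensorProduct

section SemisimpleFibre

variable {R : Type*} [CommRing R] (E : Type*) [Ring E] [Algebra R E] (p : PrimeSpectrum R)

/-- The largest semisimple quotient of the fibre `κ(p) ⊗ E` of an algebra `E` at a prime `p`. -/
def SemisimpleFibre : Type _ :=
  (p.asIdeal.ResidueField ⊗[R] E) ⧸ Ring.jacobson (p.asIdeal.ResidueField ⊗[R] E)

noncomputable instance : Ring (SemisimpleFibre E p) :=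
  inferInstanceAs (Ring ((p.asIdeal.ResidueField ⊗[R] E) ⧸
    Ring.jacobson (p.asIdeal.ResidueField ⊗[R] E)))

/-- The projection from the fibre to the semisimple fibre. -/
noncomputable def fibreMk : p.asIdeal.ResidueField ⊗[R] E →+* SemisimpleFibre E p :=
  Ideal.Quotient.mk (Ring.jacobson (p.asIdeal.ResidueField ⊗[R] E))

theorem fibreMk_surjective : Function.Surjective (fibreMk E p) := Ideal.Quotient.mk_surjective

theorem fibreMk_eq_fibreMk_iff {b b' : p.asIdeal.ResidueField ⊗[R] E} :
    fibreMk E p b = fibreMk E p b' ↔ b - b' ∈ Ring.jacobson (p.asIdeal.ResidueField ⊗[R] E) :=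
  Ideal.Quotient.eq

/-- The canonical ring homomorphism from an algebra to its semisimple fibre at `p`. -/
noncomputable def toSemisimpleFibre : E →+* SemisimpleFibre E p :=
  (fibreMk E p).comp
    (Algebra.TensorProduct.includeRight :
      E →ₐ[R] p.asIdeal.ResidueField ⊗[R] E).toRingHom

instance isArtinianRing_residueField_tensorProduct [Module.Finite R E] :
    IsArtinianRing (p.asIdeal.ResidueField ⊗[R] E) :=
  IsArtinianRing.of_finite p.asIdeal.ResidueField _

instance isSemisimpleRing_semisimpleFibre [Module.Finite R E] :
    IsSemisimpleRing (SemisimpleFibre E p) :=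
  inferInstanceAs (IsSemisimpleRing ((p.asIdeal.ResidueField ⊗[R] E) ⧸
    Ring.jacobson (p.asIdeal.ResidueField ⊗[R] E)))

variable {E p}

theorem toSemisimpleFibre_apply (e : E) :
    toSemisimpleFibre E p e = fibreMk E p (1 ⊗ₜ[R] e) := rfl

theorem one_tmul_algebraMap (r : R) :
    ((1 : p.asIdeal.ResidueField) ⊗ₜ[R] algebraMap R E r) =
      algebraMap R p.asIdeal.ResidueField r ⊗ₜ[R] (1 : E) := by
  rw [Algebra.algebraMap_eq_smul_one, Algebra.algebraMap_eq_smul_one, TensorProduct.smul_tmul]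

theorem toSemisimpleFibre_algebraMap_eq_zero {r : R} (hr : r ∈ p.asIdeal) :
    toSemisimpleFibre E p (algebraMap R E r) = 0 := by
  rw [toSemisimpleFibre_apply, one_tmul_algebraMap, Ideal.algebraMap_residueField_eq_zero.2 hr,
    TensorProduct.zero_tmul, map_zero]

theorem isUnit_toSemisimpleFibre_algebraMap {u : R} (hu : u ∉ p.asIdeal) :
    IsUnit (toSemisimpleFibre E p (algebraMap R E u)) := by
  rw [toSemisimpleFibre_apply, one_tmul_algebraMap]
  have h : IsUnit (algebraMap R p.asIdeal.ResidueField u) :=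
    isUnit_iff_ne_zero.2 fun h => hu (Ideal.algebraMap_residueField_eq_zero.1 h)
  exact (h.map (Algebra.TensorProduct.includeLeft :
    p.asIdeal.ResidueField →ₐ[R] p.asIdeal.ResidueField ⊗[R] E)).map _

/-- `κ(p)` is the fraction field of `R ⧸ p`, so denominators can be cleared by elements outside `p`.
-/
theorem exists_smul_eq_one_tmul (b : p.asIdeal.ResidueField ⊗[R] E) :
    ∃ u ∉ p.asIdeal, ∃ e : E, u • b = 1 ⊗ₜ[R] e := by
  have hp := p.isPrime
  induction b with
  | zero => exact ⟨1, hp.one_notMem, 0, by simp⟩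
  | tmul c e =>
    obtain ⟨x, y, hy, rfl⟩ := IsFractionRing.div_surjective (R ⧸ p.asIdeal) c
    obtain ⟨x, rfl⟩ := Ideal.Quotient.mk_surjective x
    obtain ⟨y, rfl⟩ := Ideal.Quotient.mk_surjective y
    have hy' : y ∉ p.asIdeal := by
      rwa [mem_nonZeroDivisors_iff_ne_zero, ne_eq, Ideal.Quotient.eq_zero_iff_mem] at hy
    refine ⟨y, hy', x • e, ?_⟩
    have h0 : algebraMap R p.asIdeal.ResidueField y ≠ 0 := fun h =>
      hy' (Ideal.algebraMap_residueField_eq_zero.1 h)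
    rw [← TensorProduct.smul_tmul, TensorProduct.smul_tmul']
    congr 1
    rw [Ideal.algebraMap_quotient_residueField_mk, Ideal.algebraMap_quotient_residueField_mk,
      Algebra.smul_def, Algebra.smul_def, mul_one, mul_div_cancel₀ _ h0]
  | add b b' hb hb' =>
    obtain ⟨u, hu, e, he⟩ := hb
    obtain ⟨u', hu', e', he'⟩ := hb'
    refine ⟨u * u', hp.mul_notMem hu hu', u' • e + u • e', ?_⟩
    rw [smul_add, mul_smul, mul_smul, smul_comm u u', he, he', TensorProduct.tmul_add,
      TensorProduct.tmul_smul, TensorProduct.tmul_smul]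

theorem exists_mul_eq_toSemisimpleFibre (a : SemisimpleFibre E p) :
    ∃ u ∉ p.asIdeal, ∃ e : E,
      toSemisimpleFibre E p (algebraMap R E u) * a = toSemisimpleFibre E p e := by
  obtain ⟨b, rfl⟩ := fibreMk_surjective E p a
  obtain ⟨u, hu, e, he⟩ := exists_smul_eq_one_tmul b
  refine ⟨u, hu, e, ?_⟩
  rw [toSemisimpleFibre_apply, toSemisimpleFibre_apply, ← he, ← map_mul, one_tmul_algebraMap,
    Algebra.smul_def]
  rfl

theorem commute_toSemisimpleFibre_algebraMap (u : R) (a : SemisimpleFibre E p) :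
    Commute (toSemisimpleFibre E p (algebraMap R E u)) a := by
  obtain ⟨b, rfl⟩ := fibreMk_surjective E p a
  rw [toSemisimpleFibre_apply, one_tmul_algebraMap]
  have : Commute (algebraMap R p.asIdeal.ResidueField u ⊗ₜ[R] (1 : E)) b := by
    change Commute (algebraMap R (p.asIdeal.ResidueField ⊗[R] E) u) b
    exact Algebra.commutes u b
  exact this.map _

/-- A common denominator for finitely many elements of the semisimple fibre. -/
theorem exists_forall_mul_eq_toSemisimpleFibre {ι : Type*} [Finite ι]
    (a : ι → SemisimpleFibre E p) :
    ∃ u ∉ p.asIdeal, ∃ e : ι → E, ∀ i,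
      toSemisimpleFibre E p (algebraMap R E u) * a i = toSemisimpleFibre E p (e i) := by
  classical
  have := Fintype.ofFinite ι
  have hp := p.isPrime
  choose u hu e he using fun i => exists_mul_eq_toSemisimpleFibre (a i)
  refine ⟨∏ i, u i, fun h => ?_, fun i => algebraMap R E (∏ j ∈ Finset.univ.erase i, u j) * e i,
    fun i => ?_⟩
  · obtain ⟨i, -, hi⟩ := hp.prod_mem_iff.1 h
    exact hu i hi
  · rw [← Finset.mul_prod_erase _ _ (Finset.mem_univ i), mul_comm, map_mul, map_mul, map_mul,
      mul_assoc, he]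

/-- The coordinatewise extension of the canonical map to finite free modules. -/
noncomputable def toFibreVec (p : PrimeSpectrum R) {ι : Type*} (x : ι → E) (i : ι) :
    SemisimpleFibre E p := toSemisimpleFibre E p (x i)

/-- The submodule of a finite free module over the semisimple fibre that is generated by the image
of a submodule `L` of the free module over `E`. -/
noncomputable def fibreSpan (p : PrimeSpectrum R) {ι : Type*} (L : Submodule E (ι → E)) :
    Submodule (SemisimpleFibre E p) (ι → SemisimpleFibre E p) :=
  Submodule.span _ (toFibreVec p '' L)

/-- Nakayama's lemma for the semisimple fibre. -/
theorem notMem_support_of_fibreSpan_eq_top [Module.Finite R E] {ι : Type*} [Finite ι]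
    (L : Submodule E (ι → E)) (hL : fibreSpan p L = ⊤) :
    p ∉ Module.support R ((ι → E) ⧸ L) := by
  classical
  have := Fintype.ofFinite ι
  rw [Module.mem_support_iff_nontrivial_residueField_tensorProduct,
    not_nontrivial_iff_subsingleton]
  let κ := p.asIdeal.ResidueField
  let B := κ ⊗[R] E
  let J : Ideal B := Ring.jacobson B
  let inc : (ι → E) → (ι → B) := fun x i => 1 ⊗ₜ[R] x i
  let W : Submodule B (ι → B) := Submodule.span B (inc '' L)
  -- The hypothesis lifted from `B ⧸ J` to `B`: `W` is everything modulo the Jacobson radical.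
  have hWJ : ∀ b : ι → B, ∃ w ∈ W, ∀ i, b i - w i ∈ J := by
    have key : ∀ v ∈ fibreSpan p L, ∃ w ∈ W, ∀ i, v i = fibreMk E p (w i) := by
      intro v hv
      induction hv using Submodule.span_induction with
      | mem v hv =>
        obtain ⟨x, hx, rfl⟩ := hv
        exact ⟨inc x, Submodule.subset_span ⟨x, hx, rfl⟩, fun i => rfl⟩
      | zero => exact ⟨0, W.zero_mem, fun i => rfl⟩
      | add v v' _ _ h h' =>
        obtain ⟨w, hw, e⟩ := h
        obtain ⟨w', hw', e'⟩ := h'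
        exact ⟨w + w', W.add_mem hw hw', fun i => by simp only [Pi.add_apply, e, e', map_add]⟩
      | smul a v _ h =>
        obtain ⟨w, hw, e⟩ := h
        obtain ⟨b, rfl⟩ := fibreMk_surjective E p a
        exact ⟨b • w, W.smul_mem b hw, fun i => by simp only [Pi.smul_apply, smul_eq_mul, e, map_mul]⟩
    intro b
    obtain ⟨w, hw, e⟩ := key (fun i => fibreMk E p (b i)) (hL ▸ Submodule.mem_top)
    exact ⟨w, hw, fun i => (fibreMk_eq_fibreMk_iff E p).1 (e i)⟩
  have hW : W = ⊤ := by
    rw [← Submodule.Quotient.subsingleton_iff]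
    by_contra h
    rw [not_subsingleton_iff_nontrivial] at h
    have hlt := Submodule.jacobson_smul_lt_top (R := B) (⊤ : Submodule B ((ι → B) ⧸ W))
    refine hlt.ne (eq_top_iff.2 fun q _ => ?_)
    obtain ⟨b, rfl⟩ := W.mkQ_surjective q
    obtain ⟨w, hw, e⟩ := hWJ b
    have h1 : W.mkQ b = ∑ i, (b i - w i) • W.mkQ (Pi.single i 1) := by
      have h2 : b - w = ∑ i, (b i - w i) • (Pi.single i 1 : ι → B) := by
        ext j
        simp [Finset.sum_apply, Pi.single_apply]
      have h3 : W.mkQ (b - w) = W.mkQ b := by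
        rw [map_sub, (Submodule.Quotient.mk_eq_zero W).2 hw |> fun h => (h : W.mkQ w = 0),
          sub_zero]
      rw [← h3, h2, map_sum]
      simp only [map_smul]
    rw [h1]
    exact Submodule.sum_mem _ fun i _ => Submodule.smul_mem_smul (e i) Submodule.mem_top
  let π (i : ι) : E →ₗ[R] (ι → E) ⧸ L :=
    (L.mkQ.restrictScalars R) ∘ₗ LinearMap.single R (fun _ => E) i
  let Φ : (ι → B) →ₗ[R] κ ⊗[R] ((ι → E) ⧸ L) :=
    ∑ i, (LinearMap.lTensor κ (π i)) ∘ₗ LinearMap.proj i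
  have hΦ : ∀ (c : κ) (x : ι → E), Φ (fun i => c ⊗ₜ[R] x i) = c ⊗ₜ[R] L.mkQ x := by
    intro c x
    have h : x = ∑ i, Pi.single i (x i) := (Finset.univ_sum_single x).symm
    conv_rhs => rw [h, map_sum, TensorProduct.tmul_sum]
    simp [Φ, π, LinearMap.sum_apply]
  -- `Φ` is only `R`-linear, so the multiplier `b` is carried along to make the span induction
  -- close.
  have hΦ0 : ∀ w ∈ W, ∀ b : B, Φ (b • w) = 0 := by
    intro w hw
    induction hw using Submodule.span_induction with
    | mem w hw =>
      obtain ⟨x, hx, rfl⟩ := hw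
      intro b
      induction b using TensorProduct.induction_on with
      | zero => rw [zero_smul, map_zero]
      | add b b' h h' => rw [add_smul, map_add, h, h', add_zero]
      | tmul c e =>
        have h1 : (c ⊗ₜ[R] e : B) • inc x = fun i => c ⊗ₜ[R] (e • x) i := by
          ext i
          simp [inc]
        rw [h1, hΦ, (Submodule.Quotient.mk_eq_zero L).2 (L.smul_mem e hx) |>
          fun h => (h : L.mkQ (e • x) = 0), TensorProduct.tmul_zero]
    | zero => intro b; rw [smul_zero, map_zero]
    | add v v' _ _ h h' => intro b; rw [smul_add, map_add, h, h', add_zero]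
    | smul a v _ h => intro b; rw [smul_smul, h]
  refine subsingleton_of_forall_eq 0 fun z => ?_
  induction z with
  | zero => rfl
  | add z z' h h' => rw [h, h', add_zero]
  | tmul c q =>
    obtain ⟨x, rfl⟩ := L.mkQ_surjective q
    rw [← hΦ, ← one_smul B (fun i => c ⊗ₜ[R] x i)]
    exact hΦ0 _ (hW ▸ Submodule.mem_top) 1

/-- Off the support, some multiple of each basis vector by an element outside `p` lies in `L`, and
that element becomes a unit in the fibre. -/
theorem fibreSpan_eq_top_of_notMem_support {ι : Type*} [Finite ι] [Module.Finite R E]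
    (L : Submodule E (ι → E)) (hL : p ∉ Module.support R ((ι → E) ⧸ L)) :
    fibreSpan p L = ⊤ := by
  classical
  have := Fintype.ofFinite ι
  rw [Module.notMem_support_iff'] at hL
  rw [eq_top_iff]
  have key : ∀ i : ι, (Pi.single i 1 : ι → SemisimpleFibre E p) ∈ fibreSpan p L := by
    intro i
    obtain ⟨u, hu, h⟩ := hL (L.mkQ (Pi.single i 1))
    have hmem : u • (Pi.single i 1 : ι → E) ∈ L := by
      change u • (L.mkQ.restrictScalars R) (Pi.single i 1) = 0 at h
      rw [← map_smul] at h
      exact (Submodule.Quotient.mk_eq_zero L).1 h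
    obtain ⟨v, hv⟩ := isUnit_toSemisimpleFibre_algebraMap (E := E) hu
    have h1 : toFibreVec p (u • (Pi.single i 1 : ι → E)) ∈ fibreSpan p L :=
      Submodule.subset_span ⟨_, hmem, rfl⟩
    have h2 : toFibreVec p (u • (Pi.single i 1 : ι → E)) =
        (v : SemisimpleFibre E p) • (Pi.single i 1 : ι → SemisimpleFibre E p) := by
      ext j
      rw [hv]
      by_cases hj : j = i
      · subst hj
        simp only [toFibreVec, Pi.smul_apply, Pi.single_eq_same, Algebra.algebraMap_eq_smul_one,
          smul_eq_mul, mul_one]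
      · simp only [toFibreVec, Pi.smul_apply, Pi.single_eq_of_ne hj, smul_zero, map_zero]
    rw [h2] at h1
    have h3 := (fibreSpan p L).smul_mem (↑v⁻¹ : SemisimpleFibre E p) h1
    rwa [smul_smul, Units.inv_mul, one_smul] at h3
  intro v _
  have : v = ∑ i, v i • (Pi.single i 1 : ι → SemisimpleFibre E p) := by
    ext j
    simp [Finset.sum_apply, Pi.single_apply]
  rw [this]
  exact Submodule.sum_mem _ fun i _ => Submodule.smul_mem _ _ (key i)

end SemisimpleFibre

/-! ### Rank of a submodule at a prime, and its semicontinuity -/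

section FibreRank

variable {R : Type*} [CommRing R] {E : Type*} [Ring E] [Algebra R E] {p : PrimeSpectrum R}

theorem fibreSpan_map {ι ι' : Type*} (L : Submodule E (ι → E)) (φ : (ι → E) →ₗ[E] (ι' → E))
    (ψ : (ι → SemisimpleFibre E p) →ₗ[SemisimpleFibre E p] (ι' → SemisimpleFibre E p))
    (h : ∀ x, ψ (toFibreVec p x) = toFibreVec p (φ x)) :
    fibreSpan p (L.map φ) = (fibreSpan p L).map ψ := by
  rw [fibreSpan, fibreSpan, Submodule.map_span, Submodule.map_coe, Set.image_image,
    Set.image_image]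
  simp only [h]

/-- The semisimple fibre at `p` of the submodule `L` of a free module contains a free module of
rank `s`. -/
def HasFibreRank (p : PrimeSpectrum R) {ι : Type*} (L : Submodule E (ι → E)) (s : ℕ) : Prop :=
  ∃ i : (Fin s → SemisimpleFibre E p) →ₗ[SemisimpleFibre E p] (ι → SemisimpleFibre E p),
    Function.Injective i ∧ ∀ x, i x ∈ fibreSpan p L

theorem exists_injective_pi_fin {A : Type*} [Ring A] {s t : ℕ} (h : s ≤ t) :
    ∃ i : (Fin s → A) →ₗ[A] (Fin t → A), Function.Injective i := by
  refine ⟨Function.ExtendByZero.linearMap A (Fin.castLE h), fun x y hxy => ?_⟩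
  ext j
  have := congrFun hxy (Fin.castLE h j)
  change Function.extend (Fin.castLE h) x 0 _ = Function.extend (Fin.castLE h) y 0 _ at this
  rwa [(Fin.castLE_injective h).extend_apply, (Fin.castLE_injective h).extend_apply] at this

theorem HasFibreRank.mono {ι : Type*} {L : Submodule E (ι → E)} {s t : ℕ}
    (h : HasFibreRank p L t) (hst : s ≤ t) : HasFibreRank p L s := by
  obtain ⟨i, hi, hL⟩ := h
  obtain ⟨j, hj⟩ := exists_injective_pi_fin (A := SemisimpleFibre E p) hst
  exact ⟨i ∘ₗ j, hi.comp hj, fun x => hL _⟩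

/-- Multiplication by `C` maps the fibre of `L` onto a free module of rank `s`, and over a
semisimple ring this surjection splits. -/
theorem HasFibreRank.of_notMem_support [Module.Finite R E] {ι : Type*} [Fintype ι]
    {L : Submodule E (ι → E)} {s : ℕ} (C : Matrix ι (Fin s) E)
    (h : p ∉ Module.support R ((Fin s → E) ⧸ L.map C.vecMulLinear)) : HasFibreRank p L s := by
  have h1 := fibreSpan_eq_top_of_notMem_support _ h
  rw [fibreSpan_map L _ (C.map (toSemisimpleFibre E p)).vecMulLinear (fun x => by
    ext j
    exact (RingHom.map_vecMul (toSemisimpleFibre E p) C x j).symm)] at h1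
  let f := (C.map (toSemisimpleFibre E p)).vecMulLinear.domRestrict (fibreSpan p L)
  have hf : Function.Surjective f := by
    intro y
    have : y ∈ (⊤ : Submodule (SemisimpleFibre E p) (Fin s → SemisimpleFibre E p)) := trivial
    rw [← h1] at this
    obtain ⟨x, hx, rfl⟩ := this
    exact ⟨⟨x, hx⟩, rfl⟩
  obtain ⟨g, hg⟩ := IsSemisimpleModule.lifting_property f hf LinearMap.id
  refine ⟨(fibreSpan p L).subtype ∘ₗ g, ?_, fun x => (g x).2⟩
  refine Subtype.val_injective.comp (Function.LeftInverse.injective (g := f) fun x => ?_)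
  exact LinearMap.congr_fun hg x

/-- A retraction of the embedding is given by a matrix over the fibre; clearing its denominators
yields `C`. -/
theorem HasFibreRank.exists_matrix [Module.Finite R E] {ι : Type*} [Fintype ι]
    {L : Submodule E (ι → E)} {s : ℕ} (h : HasFibreRank p L s) :
    ∃ C : Matrix ι (Fin s) E, p ∉ Module.support R ((Fin s → E) ⧸ L.map C.vecMulLinear) := by
  classical
  obtain ⟨i, hi, hL⟩ := h
  obtain ⟨ρ, hρ⟩ := IsSemisimpleModule.extension_property i hi LinearMap.id
  obtain ⟨u, hu, c, hc⟩ := exists_forall_mul_eq_toSemisimpleFibre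
    (fun k : ι × Fin s => ρ (Pi.single k.1 1) k.2)
  let C : Matrix ι (Fin s) E := Matrix.of fun i j => c (i, j)
  refine ⟨C, notMem_support_of_fibreSpan_eq_top _ ?_⟩
  rw [fibreSpan_map L _ (C.map (toSemisimpleFibre E p)).vecMulLinear (fun x => by
    ext j
    exact (RingHom.map_vecMul (toSemisimpleFibre E p) C x j).symm), eq_top_iff]
  intro y _
  obtain ⟨v, hv⟩ := isUnit_toSemisimpleFibre_algebraMap (E := E) hu
  have hC : ∀ x, (C.map (toSemisimpleFibre E p)).vecMulLinear x =
      (v : SemisimpleFibre E p) • ρ x := by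
    intro x
    have hx : x = ∑ i, x i • (Pi.single i 1 : ι → SemisimpleFibre E p) := by
      ext j
      simp [Finset.sum_apply, Pi.single_apply]
    ext j
    conv_rhs => rw [hx, map_sum, Finset.smul_sum, Finset.sum_apply]
    rw [Matrix.vecMulLinear_apply, Matrix.vecMul, dotProduct]
    refine Finset.sum_congr rfl fun k _ => ?_
    have h1 := hc (k, j)
    rw [← hv] at h1
    have h2 : (v : SemisimpleFibre E p) * x k = x k * v :=
      hv ▸ commute_toSemisimpleFibre_algebraMap u (x k)
    rw [map_smul, Pi.smul_apply, Pi.smul_apply, smul_eq_mul, smul_eq_mul, ← mul_assoc, h2,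
      mul_assoc, h1]
    rfl
  refine ⟨i ((↑v⁻¹ : SemisimpleFibre E p) • y), hL _, ?_⟩
  have h3 : ρ (i ((↑v⁻¹ : SemisimpleFibre E p) • y)) = (↑v⁻¹ : SemisimpleFibre E p) • y :=
    LinearMap.congr_fun hρ _
  rw [hC, h3, smul_smul, Units.mul_inv, one_smul]

/-- The matrix that witnesses the rank at `p` also does so off the support of a finite module, which
is closed. -/
theorem isOpen_setOf_hasFibreRank [Module.Finite R E] {ι : Type*} [Fintype ι]
    (L : Submodule E (ι → E)) (s : ℕ) : IsOpen {p : PrimeSpectrum R | HasFibreRank p L s} := by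
  rw [isOpen_iff_forall_mem_open]
  intro p hp
  obtain ⟨C, hC⟩ := HasFibreRank.exists_matrix hp
  exact ⟨(Module.support R ((Fin s → E) ⧸ L.map C.vecMulLinear))ᶜ,
    fun q hq => HasFibreRank.of_notMem_support C hq, Module.isClosed_support.isOpen_compl, hC⟩

/-- A submodule of a free module of rank `n` that has rank `n` at `p` is everything at `p`. -/
theorem HasFibreRank.notMem_support [Module.Finite R E] {n : ℕ} {L : Submodule E (Fin n → E)}
    (h : HasFibreRank p L n) : p ∉ Module.support R ((Fin n → E) ⧸ L) := by
  obtain ⟨i, hi, hL⟩ := h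
  refine notMem_support_of_fibreSpan_eq_top L (eq_top_iff.2 fun y _ => ?_)
  obtain ⟨x, rfl⟩ := IsArtinian.surjective_of_injective_endomorphism i hi y
  exact hL x

/-! ### Shears that preserve ranks -/

/-- The projection from a free module of rank `n + 1` to one of rank `n` along `(-1, a)`. -/
def shear {A : Type*} [Ring A] {n : ℕ} (a : Fin n → A) :
    (Fin (n + 1) → A) →ₗ[A] (Fin n → A) where
  toFun x j := x j.succ + x 0 * a j
  map_add' x y := by
    ext j
    simp only [Pi.add_apply, add_mul]
    abel
  map_smul' c x := by
    ext j
    simp only [Pi.smul_apply, smul_eq_mul, RingHom.id_apply, mul_add, mul_assoc]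

theorem shear_apply {A : Type*} [Ring A] {n : ℕ} (a : Fin n → A) (x : Fin (n + 1) → A)
    (j : Fin n) : shear a x j = x j.succ + x 0 * a j := rfl

theorem eq_zero_of_shear_eq_zero {A : Type*} [Ring A] {n : ℕ} {a : Fin n → A}
    {x : Fin (n + 1) → A} (h : shear a x = 0) (h0 : x 0 = 0) : x = 0 := by
  ext j
  refine Fin.cases h0 (fun j => ?_) j
  have := congrFun h j
  rwa [shear_apply, h0, zero_mul, add_zero] at this

theorem fibreSpan_map_shear {n : ℕ} (L : Submodule E (Fin (n + 1) → E)) (a : Fin n → E) :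
    fibreSpan p (L.map (shear a)) = (fibreSpan p L).map (shear (toFibreVec p a)) := by
  refine fibreSpan_map L _ _ fun x => ?_
  ext j
  simp only [shear_apply, toFibreVec, map_add, map_mul]

/-- The shear together with the coordinate `x 0` is injective, so one copy of the ring can be
cancelled. -/
theorem HasFibreRank.map_shear [Module.Finite R E] {n s : ℕ}
    {L : Submodule E (Fin (n + 1) → E)} (h : HasFibreRank p L (s + 1)) (a : Fin n → E) :
    HasFibreRank p (L.map (shear a)) s := by
  obtain ⟨i, hi, hL⟩ := h
  have hmem : ∀ x, (shear (toFibreVec p a) ∘ₗ i) x ∈ fibreSpan p (L.map (shear a)) := by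
    intro x
    rw [fibreSpan_map_shear]
    exact ⟨_, hL x, rfl⟩
  obtain ⟨g, hg⟩ := exists_injective_of_succ
    ((LinearMap.proj 0 ∘ₗ i).prod (LinearMap.codRestrict _ _ hmem)) (by
      rw [← LinearMap.ker_eq_bot, LinearMap.ker_eq_bot']
      intro x hx
      have h0 : i x 0 = 0 := congrArg Prod.fst hx
      have h1 : shear (toFibreVec p a) (i x) = 0 := congrArg Subtype.val (congrArg Prod.snd hx)
      exact hi ((eq_zero_of_shear_eq_zero h1 h0).trans (map_zero i).symm))
  exact ⟨Submodule.subtype _ ∘ₗ g, Subtype.val_injective.comp hg, fun x => (g x).2⟩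

/-- General position at one prime. The free factor `r` allows the correction to vanish at other
primes. -/
theorem HasFibreRank.exists_shear [Module.Finite R E] {n s : ℕ}
    {L : Submodule E (Fin (n + 1) → E)} (h : HasFibreRank p L s) (hs : s ≤ n) (a : Fin n → E) :
    ∃ b : Fin n → E, ∀ r : R, r ∉ p.asIdeal →
      HasFibreRank p (L.map (shear (a + r • b))) s := by
  have hp := p.isPrime
  obtain ⟨i, hi, hL⟩ := h
  obtain ⟨j, hj⟩ := exists_injective_pi_fin (A := SemisimpleFibre E p) hs
  obtain ⟨b, hb⟩ := exists_shear_injective (shear (toFibreVec p a) ∘ₗ i) (LinearMap.proj 0 ∘ₗ i)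
    (by
      rw [← LinearMap.ker_eq_bot, LinearMap.ker_eq_bot']
      intro x hx
      have h0 : i x 0 = 0 := congrArg Prod.snd hx
      have h1 : shear (toFibreVec p a) (i x) = 0 := congrArg Prod.fst hx
      exact hi ((eq_zero_of_shear_eq_zero h1 h0).trans (map_zero i).symm)) j hj
  obtain ⟨u, hu, e, he⟩ := exists_forall_mul_eq_toSemisimpleFibre (b 1)
  refine ⟨e, fun r hr => ⟨shear (toFibreVec p (a + r • e)) ∘ₗ i, ?_, fun x => ?_⟩⟩
  · rw [← LinearMap.ker_eq_bot, LinearMap.ker_eq_bot']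
    intro x hx
    refine hb _ (isUnit_toSemisimpleFibre_algebraMap (hp.mul_notMem hr hu)) x ?_
    rw [← hx]
    ext k
    have h1 : b (i x 0) = i x 0 • b 1 := by rw [← map_smul, smul_eq_mul, mul_one]
    have h2 : toSemisimpleFibre E p (r • e k) =
        toSemisimpleFibre E p (algebraMap R E (r * u)) * b 1 k := by
      rw [map_mul, map_mul, mul_assoc, he, Algebra.smul_def, map_mul]
    have h3 := (commute_toSemisimpleFibre_algebraMap (E := E) (p := p) (r * u) (i x 0)).eq
    simp only [Pi.add_apply, Pi.smul_apply, LinearMap.comp_apply, LinearMap.proj_apply, h1,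
      shear_apply, toFibreVec, map_add, h2, smul_eq_mul, mul_add, ← mul_assoc, h3, add_assoc]
  · rw [fibreSpan_map_shear]
    exact ⟨_, hL x, rfl⟩

theorem fibreSpan_map_shear_add_smul {n : ℕ} (L : Submodule E (Fin (n + 1) → E))
    (a b : Fin n → E) {r : R} (hr : r ∈ p.asIdeal) :
    fibreSpan p (L.map (shear (a + r • b))) = fibreSpan p (L.map (shear a)) := by
  rw [fibreSpan_map_shear, fibreSpan_map_shear]
  congr 2
  ext j
  rw [toFibreVec, Pi.add_apply, Pi.smul_apply, map_add, Algebra.smul_def, map_mul,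
    toSemisimpleFibre_algebraMap_eq_zero hr, zero_mul, add_zero, toFibreVec]

theorem exists_shear_forall_hasFibreRank [Module.Finite R E] {n : ℕ}
    (L : Submodule E (Fin (n + 1) → E)) (s : PrimeSpectrum R → ℕ) (Λ : Finset (PrimeSpectrum R))
    (hs : ∀ p ∈ Λ, s p ≤ n) (hL : ∀ p ∈ Λ, HasFibreRank p L (s p)) :
    ∃ a : Fin n → E, ∀ p ∈ Λ, HasFibreRank p (L.map (shear a)) (s p) := by
  classical
  induction Λ using Finset.strongInduction with
  | H Λ ih =>
    rcases Λ.eq_empty_or_nonempty with rfl | hne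
    · exact ⟨0, by simp⟩
    -- By minimality no other prime of `Λ` lies in `p`, so some element outside `p` lies in all of
    -- them. Multiplying the correction at `p` by it leaves their fibres unchanged.
    obtain ⟨p, hpΛ, hp⟩ := Λ.exists_minimal hne
    obtain ⟨a, ha⟩ := ih (Λ.erase p) (Finset.erase_ssubset hpΛ)
      (fun q hq => hs q (Finset.mem_of_mem_erase hq))
      (fun q hq => hL q (Finset.mem_of_mem_erase hq))
    obtain ⟨b, hb⟩ := (hL p hpΛ).exists_shear (hs p hpΛ) a
    have hr : ∀ q : PrimeSpectrum R, ∃ r : R, r ∉ p.asIdeal ∧ (q ∈ Λ.erase p → r ∈ q.asIdeal) := by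
      intro q
      by_cases hq : q ∈ Λ.erase p
      · have hqp : ¬ q.asIdeal ≤ p.asIdeal := fun h =>
          Finset.ne_of_mem_erase hq (le_antisymm h (hp (Finset.mem_of_mem_erase hq) h))
        obtain ⟨r, h1, h2⟩ := SetLike.not_le_iff_exists.1 hqp
        exact ⟨r, h2, fun _ => h1⟩
      · exact ⟨1, p.isPrime.one_notMem, fun h => absurd h hq⟩
    choose r hr1 hr2 using hr
    refine ⟨a + (∏ q ∈ Λ.erase p, r q) • b, fun q hq => ?_⟩
    by_cases hqp : q = p
    · subst hqp
      refine hb _ fun h => ?_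
      obtain ⟨q', -, h'⟩ := q.isPrime.prod_mem_iff.1 h
      exact hr1 q' h'
    · have hq' := Finset.mem_erase.2 ⟨hqp, hq⟩
      rw [HasFibreRank, fibreSpan_map_shear_add_smul]
      · exact ha q hq'
      · exact Ideal.mem_of_dvd _ (Finset.dvd_prod_of_mem r hq') (hr2 q hq')

/-- Every closed subset of `j-Spec` has finitely many elements such that each element contains one
of them. -/
theorem exists_finset_generic [IsNoetherianRing R] {C Y : Set (PrimeSpectrum R)} (hC : IsClosed C)
    (hY : Y = jSpec R ∩ C) :
    ∃ Λ : Finset (PrimeSpectrum R), (Λ : Set (PrimeSpectrum R)) ⊆ Y ∧ ∀ p ∈ Y, ∃ q ∈ Λ, q ≤ p := by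
  classical
  let I : Ideal R := sInf (PrimeSpectrum.asIdeal '' Y)
  have hfin : {q : PrimeSpectrum R | q.asIdeal ∈ I.minimalPrimes}.Finite :=
    (I.finite_minimalPrimes_of_isNoetherianRing).preimage
      (fun _ _ _ _ h => PrimeSpectrum.ext h)
  have hIY : ∀ p ∈ Y, I ≤ p.asIdeal := fun p hp => sInf_le ⟨p, hp, rfl⟩
  have hmin : ∀ p ∈ Y, ∃ q ∈ hfin.toFinset, q ≤ p := by
    intro p hp
    have := p.isPrime
    obtain ⟨q, hq, hqp⟩ := Ideal.exists_minimalPrimes_le (hIY p hp)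
    have := hq.1.1
    exact ⟨⟨q, this⟩, by simpa using hq, hqp⟩
  refine ⟨hfin.toFinset, fun q hq => ?_, hmin⟩
  have hqI : q.asIdeal ∈ I.minimalPrimes := by simpa using hq
  -- The product of the `J q'` lies in `I`, hence in `q`. Primality and minimality give `J q ≤ q`,
  -- so `q` is an intersection of points of `Y` and therefore belongs to `Y`.
  let J : PrimeSpectrum R → Ideal R := fun q' => sInf (PrimeSpectrum.asIdeal '' {p ∈ Y | q' ≤ p})
  have hJq : J q = q.asIdeal := by
    have h1 : ∀ q', q'.asIdeal ≤ J q' := fun q' => le_sInf (by rintro _ ⟨p, hp, rfl⟩; exact hp.2)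
    have h2 : ∏ q' ∈ hfin.toFinset, J q' ≤ q.asIdeal := by
      refine (Ideal.prod_le_inf.trans (le_sInf ?_)).trans hqI.1.2
      rintro _ ⟨p, hp, rfl⟩
      obtain ⟨q', hq', hle⟩ := hmin p hp
      exact (Finset.inf_le hq').trans (sInf_le ⟨p, ⟨hp, hle⟩, rfl⟩)
    obtain ⟨q', hq', hle⟩ := (q.isPrime.prod_le).1 h2
    have h3 : q'.asIdeal ∈ I.minimalPrimes := by simpa using hq'
    have h4 : q' = q := PrimeSpectrum.ext
      (le_antisymm ((h1 q').trans hle) (hqI.2 h3.1 ((h1 q').trans hle)))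
    rw [h4] at hle
    exact le_antisymm hle (h1 q)
  rw [hY]
  constructor
  · refine ⟨{m | m.IsMaximal ∧ q.asIdeal ≤ m}, fun m hm => hm.1,
      le_antisymm (le_sInf fun m hm => hm.2) ?_⟩
    conv_rhs => rw [← hJq]
    refine le_sInf ?_
    rintro _ ⟨p, ⟨hp, hqp⟩, rfl⟩
    rw [hY] at hp
    obtain ⟨T, hT, hpT⟩ := hp.1
    rw [hpT]
    refine le_sInf fun m hm => sInf_le ⟨hT m hm, ?_⟩
    have h5 : p.asIdeal ≤ m := hpT ▸ sInf_le hm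
    exact le_trans hqp h5
  · obtain ⟨I', rfl⟩ := (PrimeSpectrum.isClosed_iff_zeroLocus_ideal C).1 hC
    rw [PrimeSpectrum.mem_zeroLocus, SetLike.coe_subset_coe, ← hJq]
    refine le_sInf ?_
    rintro _ ⟨p, ⟨hp, hqp⟩, rfl⟩
    rw [hY] at hp
    exact hp.2

/-- A submodule of `E ^ n` with sufficiently large rank at all points of `j-Spec` on which `E` is
supported has `E ^ t` as an image under an `E`-linear map. -/
theorem exists_linearMap_map_eq_top [IsNoetherianRing R] [Module.Finite R E]
    {C X : Set (PrimeSpectrum R)} (hC : IsClosed C) (hX : X = jSpec R ∩ C)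
    (hE : Module.support R E ⊆ C) (d : PrimeSpectrum R → ℕ)
    (hd : ∀ p ∈ X, ∀ q ∈ X, q < p → d p < d q) {n t : ℕ} (hn : t ≤ n)
    (L : Submodule E (Fin n → E)) (hL : ∀ p ∈ X, HasFibreRank p L (min n (t + d p))) :
    ∃ φ : (Fin n → E) →ₗ[E] (Fin t → E), L.map φ = ⊤ := by
  classical
  induction n, hn using Nat.le_induction with
  | base =>
    refine ⟨LinearMap.id, ?_⟩
    rw [Submodule.map_id]
    by_contra hne
    have hnt : Nontrivial ((Fin t → E) ⧸ L) := Submodule.Quotient.nontrivial_iff.2 hne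
    obtain ⟨p, hp⟩ := (Module.nonempty_support_iff (R := R)).2 hnt
    obtain ⟨m, hm, hpm⟩ := Ideal.exists_le_maximal p.asIdeal p.isPrime.ne_top
    -- A nonzero quotient is supported at a maximal ideal; this lies in `X`, where the rank is `t`.
    let P : PrimeSpectrum R := ⟨m, hm.isPrime⟩
    have hP : P ∈ Module.support R ((Fin t → E) ⧸ L) := Module.mem_support_mono hpm hp
    have hPE : P ∈ Module.support R E := by
      by_contra h
      rw [Module.notMem_support_iff'] at h
      obtain ⟨u, hu, h1⟩ := h 1
      refine Module.notMem_support_iff'.2 (fun q => ⟨u, hu, ?_⟩) hP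
      obtain ⟨x, rfl⟩ := L.mkQ_surjective q
      have : u • x = 0 := by
        ext j
        rw [Pi.smul_apply, ← one_mul (x j), ← smul_mul_assoc, h1, zero_mul, Pi.zero_apply]
      change u • (L.mkQ.restrictScalars R) x = 0
      rw [← map_smul, this, map_zero]
    have hPX : P ∈ X := by
      rw [hX]
      exact ⟨⟨{m}, by simpa using hm, by simp [P]⟩, hE hPE⟩
    have := hL P hPX
    rw [min_eq_left (Nat.le_add_right _ _)] at this
    exact this.notMem_support hP
  | succ n hn ih =>
    have hgen : ∀ k : ℕ, ∃ Λ : Finset (PrimeSpectrum R),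
        (Λ : Set (PrimeSpectrum R)) ⊆ {p ∈ X | ¬ HasFibreRank p L (k + 1)} ∧
        ∀ p ∈ {p ∈ X | ¬ HasFibreRank p L (k + 1)}, ∃ q ∈ Λ, q ≤ p := by
      intro k
      refine exists_finset_generic
        (C := C ∩ {p : PrimeSpectrum R | HasFibreRank p L (k + 1)}ᶜ)
        (hC.inter (isOpen_setOf_hasFibreRank L (k + 1)).isClosed_compl) ?_
      rw [hX, ← Set.inter_assoc]
      rfl
    choose Λ hΛ1 hΛ2 using hgen
    have hΛX : ∀ p ∈ (Finset.range (n + 1)).biUnion Λ, p ∈ X := by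
      intro p hp
      obtain ⟨k, -, hk⟩ := Finset.mem_biUnion.1 hp
      exact (hΛ1 k hk).1
    obtain ⟨a, ha⟩ := exists_shear_forall_hasFibreRank L (fun p => min n (t + d p))
      ((Finset.range (n + 1)).biUnion Λ) (fun p _ => min_le_left _ _)
      (fun p hp => (hL p (hΛX p hp)).mono (min_le_min_right _ (Nat.le_succ n)))
    obtain ⟨φ, hφ⟩ := ih (L.map (shear a)) fun p hp => by
      by_cases hr : HasFibreRank p L (min n (t + d p) + 1)
      · exact hr.map_shear a
      · obtain ⟨q, hq, hqp⟩ := hΛ2 _ p ⟨hp, hr⟩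
        have hqX := hΛ1 _ hq
        rcases eq_or_lt_of_le hqp with rfl | hlt
        · refine ha q (Finset.mem_biUnion.2 ⟨_, ?_, hq⟩)
          exact Finset.mem_range.2 (Nat.lt_succ_of_le (min_le_left _ _))
        -- Since `d p < d q`, the rank guaranteed at `q`, namely `min (n + 1) (t + d q)`, is at
        -- least `min n (t + d p) + 1`, but `q` was chosen where this rank fails.
        · refine absurd ((hL q hqX.1).mono ?_) hqX.2
          have := hd p hp q hqX.1 hlt
          omega
    exact ⟨φ ∘ₗ shear a, by rw [Submodule.map_comp, hφ]⟩

end FibreRank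

/-! ### The dimension function on `X` -/

section Dimension

variable {R : Type*} [CommRing R]

theorem dimAt_ne_bot {X : Set (PrimeSpectrum R)} {p : PrimeSpectrum R} (hp : p ∈ X) :
    dimAt X p ≠ ⊥ :=
  Order.krullDim_ne_bot_iff.2
    ⟨⟨closure {⟨p, le_refl p.asIdeal, hp⟩}, isIrreducible_singleton.closure, isClosed_closure⟩⟩

theorem dimAt_le_topologicalKrullDim (X : Set (PrimeSpectrum R)) (p : PrimeSpectrum R) :
    dimAt X p ≤ topologicalKrullDim ↥X :=
  (Topology.IsEmbedding.inclusion Set.inter_subset_right).isInducing.topologicalKrullDim_le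

/-- The points of `X` above `q` form an irreducible space with generic point `q`. Closures of
irreducible closed sets of points above `p` miss `q`, so the whole space can be added on top of any
chain of them. -/
theorem dimAt_add_one_le {X : Set (PrimeSpectrum R)} {p q : PrimeSpectrum R} (hp : p ∈ X)
    (hq : q ∈ X) (hqp : q < p) : dimAt X p + 1 ≤ dimAt X q := by
  let U : Set (PrimeSpectrum R) := {q' : PrimeSpectrum R | p.asIdeal ≤ q'.asIdeal} ∩ X
  let V : Set (PrimeSpectrum R) := {q' : PrimeSpectrum R | q.asIdeal ≤ q'.asIdeal} ∩ X
  have hUV : U ⊆ V := fun x hx => ⟨le_trans hqp.le hx.1, hx.2⟩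
  have hind := (Topology.IsEmbedding.inclusion hUV).isInducing
  let q₀ : V := ⟨q, le_refl q.asIdeal, hq⟩
  have hne : Nonempty (TopologicalSpace.IrreducibleCloseds U) :=
    ⟨⟨closure {⟨p, le_refl p.asIdeal, hp⟩}, isIrreducible_singleton.closure, isClosed_closure⟩⟩
  have hdense : closure {q₀} = Set.univ := by
    refine Set.eq_univ_of_forall fun x => ?_
    rw [← specializes_iff_mem_closure, ← Topology.IsInducing.subtypeVal.specializes_iff,
      ← PrimeSpectrum.le_iff_specializes]
    exact x.2.1
  let W : TopologicalSpace.IrreducibleCloseds V :=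
    ⟨Set.univ, hdense ▸ isIrreducible_singleton.closure, isClosed_univ⟩
  have hlt : ∀ Z, TopologicalSpace.IrreducibleCloseds.map (Set.inclusion hUV) hind.continuous Z
      < W := by
    intro Z
    refine lt_of_le_of_ne (fun _ _ => trivial) fun h => ?_
    have h1 : q₀ ∈ closure (Set.inclusion hUV '' (Z : Set U)) := by
      rw [← TopologicalSpace.IrreducibleCloseds.coe_map _ hind.continuous, h]
      trivial
    have h2 : IsClosed {x : V | p.asIdeal ≤ x.1.asIdeal} :=
      (PrimeSpectrum.isClosed_zeroLocus (p.asIdeal : Set R)).preimage continuous_subtype_val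
    have h3 : q₀ ∈ {x : V | p.asIdeal ≤ x.1.asIdeal} := by
      refine closure_minimal ?_ h2 h1
      rintro _ ⟨x, -, rfl⟩
      exact x.2.1
    exact not_le_of_gt hqp h3
  have key := Order.krullDim_le_of_strictMono
    (WithTop.recTopCoe (C := fun _ => TopologicalSpace.IrreducibleCloseds V) W
      (TopologicalSpace.IrreducibleCloseds.map (Set.inclusion hUV) hind.continuous)) (by
      intro a b hab
      induction b with
      | top =>
        lift a to TopologicalSpace.IrreducibleCloseds U using hab.ne
        exact hlt a
      | coe b =>
        lift a to TopologicalSpace.IrreducibleCloseds U using (hab.trans (WithTop.coe_lt_top b)).ne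
        exact TopologicalSpace.IrreducibleCloseds.map_strictMono_of_isInducing hind
          (WithTop.coe_lt_coe.1 hab))
  rwa [Order.krullDim_WithTop] at key

theorem exists_nat_eq_dimAt {X : Set (PrimeSpectrum R)} (hX : topologicalKrullDim ↥X < ⊤)
    {p : PrimeSpectrum R} (hp : p ∈ X) : ∃ d : ℕ, dimAt X p = ((d : ℕ∞) : WithBot ℕ∞) := by
  have h1 := dimAt_ne_bot hp
  have h2 := (dimAt_le_topologicalKrullDim X p).trans_lt hX
  obtain ⟨e, he⟩ := WithBot.ne_bot_iff_exists.1 h1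
  rw [← he] at h2 ⊢
  have h3 : e ≠ ⊤ := by
    rintro rfl
    exact lt_irrefl _ h2
  obtain ⟨d, rfl⟩ := ENat.ne_top_iff_exists.1 h3
  exact ⟨d, rfl⟩

end Dimension

/-! ### Descending local splittings to global maps -/

section Localization

variable {R S M N : Type*} [CommRing R] [Ring S] [Algebra R S]
  [AddCommGroup M] [Module R M] [Module Sᵐᵒᵖ M] [IsScalarTower R Sᵐᵒᵖ M]
  [AddCommGroup N] [Module R N] [Module Sᵐᵒᵖ N] [IsScalarTower R Sᵐᵒᵖ N]

theorem LocalizedModule.op_mk_algebraMap_smul {W : Submonoid R} (r : R)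
    (y : LocalizedModule W M) :
    MulOpposite.op (LocalizedModule.mk (algebraMap R S r) (1 : W)) • y = r • y := by
  induction y using LocalizedModule.induction_on with
  | h m s =>
    rw [LocalizedModule.op_mk_smul_mk, one_mul, LocalizedModule.smul'_mk,
      ← MulOpposite.algebraMap_apply, algebraMap_smul]

/-- Maps between localizations at `W` come from maps of the modules after multiplication with a
denominator. -/
theorem exists_linearMap_of_localizedModule [IsNoetherianRing R] [Module.Finite R S]
    [Module.Finite R M] {W : Submonoid R}
    (h : LocalizedModule W M →ₗ[(LocalizedModule W S)ᵐᵒᵖ] LocalizedModule W N) :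
    ∃ (f : M →ₗ[Sᵐᵒᵖ] N) (u : R), u ∈ W ∧
      ∀ x, LocalizedModule.mkLinearMap W N (f x) = u • h (LocalizedModule.mkLinearMap W M x) := by
  have := Module.finitePresentation_of_finite R M
  let hR : LocalizedModule W M →ₗ[R] LocalizedModule W N :=
    { toFun := h
      map_add' := map_add h
      map_smul' := fun r y => by
        rw [← LocalizedModule.op_mk_algebraMap_smul (S := S), map_smul,
          LocalizedModule.op_mk_algebraMap_smul, RingHom.id_apply] }
  obtain ⟨f, s, hf⟩ := Module.FinitePresentation.exists_lift_of_isLocalizedModule W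
    (LocalizedModule.mkLinearMap W N) (hR ∘ₗ LocalizedModule.mkLinearMap W M)
  have hf' : ∀ x, LocalizedModule.mkLinearMap W N (f x) =
      (s : R) • h (LocalizedModule.mkLinearMap W M x) := fun x => LinearMap.congr_fun hf x
  -- The lift `f` is only `R`-linear. The maps `b₁` and `b₂` measure its failure to be `S`-linear;
  -- they agree after localization, and since `S ⊗ M` is finite over `R`, a single multiplier `v`
  -- makes them agree.
  let b₁ : S →ₗ[R] M →ₗ[R] N := LinearMap.mk₂ R (fun a x => f (MulOpposite.op a • x))
    (fun a a' x => by rw [MulOpposite.op_add, add_smul, map_add])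
    (fun r a x => by rw [MulOpposite.op_smul, smul_assoc, map_smul])
    (fun a x x' => by rw [smul_add, map_add])
    (fun r a x => by rw [LocalizedModule.op_smul_smul_comm, map_smul])
  let b₂ : S →ₗ[R] M →ₗ[R] N := LinearMap.mk₂ R (fun a x => MulOpposite.op a • f x)
    (fun a a' x => by rw [MulOpposite.op_add, add_smul])
    (fun r a x => by rw [MulOpposite.op_smul, smul_assoc])
    (fun a x x' => by rw [map_add, smul_add])
    (fun r a x => by rw [map_smul, LocalizedModule.op_smul_smul_comm])
  have hmk : ∀ (a : S) (x : N), LocalizedModule.mkLinearMap W N (MulOpposite.op a • x) =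
      MulOpposite.op (LocalizedModule.mk a (1 : W)) • LocalizedModule.mkLinearMap W N x := by
    intro a x
    rw [LocalizedModule.mkLinearMap_apply, LocalizedModule.mkLinearMap_apply,
      LocalizedModule.op_mk_smul_mk, one_mul]
  obtain ⟨v, hv⟩ := Module.Finite.exists_smul_of_comp_eq_of_isLocalizedModule W
    (LocalizedModule.mkLinearMap W N) (TensorProduct.lift b₁) (TensorProduct.lift b₂) (by
      refine TensorProduct.ext' fun a x => ?_
      change LocalizedModule.mkLinearMap W N (f (MulOpposite.op a • x)) =
        LocalizedModule.mkLinearMap W N (MulOpposite.op a • f x)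
      have h1 : LocalizedModule.mkLinearMap W M (MulOpposite.op a • x) =
          MulOpposite.op (LocalizedModule.mk a (1 : W)) • LocalizedModule.mkLinearMap W M x := by
        rw [LocalizedModule.mkLinearMap_apply, LocalizedModule.mkLinearMap_apply,
          LocalizedModule.op_mk_smul_mk, one_mul]
      rw [hf', h1, map_smul, hmk, hf', ← LocalizedModule.op_mk_algebraMap_smul (S := S),
        ← LocalizedModule.op_mk_algebraMap_smul (S := S), ← mul_smul, ← mul_smul,
        ← MulOpposite.op_mul, ← MulOpposite.op_mul, LocalizedModule.mk_mul_mk,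
        LocalizedModule.mk_mul_mk, Algebra.commutes])
  have hv' : ∀ (a : S) (x : M),
      (v : R) • f (MulOpposite.op a • x) = (v : R) • MulOpposite.op a • f x :=
    fun a x => LinearMap.congr_fun hv (a ⊗ₜ[R] x)
  refine ⟨{ toFun := fun x => (v : R) • f x
            map_add' := fun x y => by rw [map_add, smul_add]
            map_smul' := fun a x => by
              rw [RingHom.id_apply, ← MulOpposite.op_unop a, hv',
                LocalizedModule.op_smul_smul_comm] }, v * s, W.mul_mem v.2 s.2, fun x => ?_⟩
  change LocalizedModule.mkLinearMap W N ((v : R) • f x) = _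
  rw [map_smul, hf', mul_smul]

theorem exists_forall_linearMap_of_localizedModule [IsNoetherianRing R] [Module.Finite R S]
    [Module.Finite R M] {W : Submonoid R} {ι : Type*} [Finite ι]
    (h : ι → LocalizedModule W M →ₗ[(LocalizedModule W S)ᵐᵒᵖ] LocalizedModule W N) :
    ∃ (f : ι → M →ₗ[Sᵐᵒᵖ] N) (u : R), u ∈ W ∧ ∀ i x,
      LocalizedModule.mkLinearMap W N (f i x) = u • h i (LocalizedModule.mkLinearMap W M x) := by
  classical
  have := Fintype.ofFinite ι
  have : SMulCommClass R Sᵐᵒᵖ N := IsScalarTower.to_smulCommClass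
  have : SMulCommClass Sᵐᵒᵖ R N := SMulCommClass.symm _ _ _
  choose f u hu hf using fun i => exists_linearMap_of_localizedModule (h i)
  refine ⟨fun i => (∏ j ∈ Finset.univ.erase i, u j) • f i, ∏ i, u i,
    W.prod_mem fun i _ => hu i, fun i x => ?_⟩
  rw [LinearMap.smul_apply, map_smul, hf, ← mul_smul,
    Finset.prod_erase_mul _ _ (Finset.mem_univ i)]

/-- A split surjection `M_p → (N_p) ^ t` gives maps between `M` and `N` that compose to a multiple of
the identity matrix. -/
theorem exists_comp_eq_smul_of_le_localSplittingCapacity [IsNoetherianRing R]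
    [Module.Finite R S] [Module.Finite R M] [Module.Finite R N] [SMulCommClass Sᵐᵒᵖ R N]
    {p : PrimeSpectrum R} {s : ℕ} (hs : (s : ℕ∞) ≤ localSplittingCapacity S M N p) :
    ∃ (f : Fin s → M →ₗ[Sᵐᵒᵖ] N) (g : Fin s → N →ₗ[Sᵐᵒᵖ] M) (w : R), w ∉ p.asIdeal ∧
      ∀ i j, f i ∘ₗ g j = if i = j then w • LinearMap.id else 0 := by
  classical
  obtain ⟨t, hst, hf, hg, hfg⟩ : ∃ t : ℕ, s ≤ t ∧
      ∃ (f : LocalizedModule p.asIdeal.primeCompl M →ₗ[(LocalizedModule p.asIdeal.primeCompl S)ᵐᵒᵖ]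
          (Fin t → LocalizedModule p.asIdeal.primeCompl N))
        (g : (Fin t → LocalizedModule p.asIdeal.primeCompl N)
          →ₗ[(LocalizedModule p.asIdeal.primeCompl S)ᵐᵒᵖ]
          LocalizedModule p.asIdeal.primeCompl M), f ∘ₗ g = LinearMap.id := by
    -- The supremum need not be attained, so for `s = k + 1` an admissible `t > k` is taken.
    rcases s with _ | k
    · exact ⟨0, le_rfl, 0, 0, LinearMap.ext fun _ => Subsingleton.elim _ _⟩
    · have h1 : (k : ℕ∞) < localSplittingCapacity S M N p :=
        lt_of_lt_of_le (by exact_mod_cast Nat.lt_succ_self k) hs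
      obtain ⟨_, ⟨t, rfl, h⟩, h2⟩ := lt_sSup_iff.1 h1
      exact ⟨t, by exact_mod_cast h2, h⟩
  let W := p.asIdeal.primeCompl
  have : SMulCommClass R Sᵐᵒᵖ N := SMulCommClass.symm _ _ _
  obtain ⟨f, u, hu, hf'⟩ := exists_forall_linearMap_of_localizedModule
    (fun i => LinearMap.proj i ∘ₗ hf)
  obtain ⟨g, u', hu', hg'⟩ := exists_forall_linearMap_of_localizedModule
    (fun i => hg ∘ₗ LinearMap.single _ (fun _ => LocalizedModule W N) i)
  -- Each matrix entry is correct up to some `v` outside `p`; the product of these then works for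
  -- all entries.
  have key : ∀ (ij : Fin t × Fin t), ∃ v : W, ∀ x, (v : R) • f ij.1 (g ij.2 x) =
      (v : R) • if ij.1 = ij.2 then (u * u') • x else 0 := by
    rintro ⟨i, j⟩
    obtain ⟨v, hv⟩ := Module.Finite.exists_smul_of_comp_eq_of_isLocalizedModule W
      (LocalizedModule.mkLinearMap W N) ((f i ∘ₗ g j).restrictScalars R)
      (if i = j then (u * u') • LinearMap.id else 0) (by
        ext x
        have h1 : ∀ y, (LinearMap.proj i ∘ₗ hf) (u' • y) = u' • (LinearMap.proj i ∘ₗ hf) y := by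
          intro y
          rw [← LocalizedModule.op_mk_algebraMap_smul (S := S), map_smul,
            LocalizedModule.op_mk_algebraMap_smul]
        have h2 : (LinearMap.proj i ∘ₗ hf) ((hg ∘ₗ LinearMap.single _
            (fun _ => LocalizedModule W N) j) (LocalizedModule.mkLinearMap W N x)) =
            (Pi.single j (LocalizedModule.mkLinearMap W N x) : Fin t → LocalizedModule W N) i :=
          congrFun (LinearMap.congr_fun hfg _) i
        change LocalizedModule.mkLinearMap W N (f i (g j x)) = LocalizedModule.mkLinearMap W N _
        rw [hf', hg', h1, h2, ← mul_smul]
        by_cases hij : i = j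
        · subst hij
          rw [Pi.single_eq_same, if_pos rfl, LinearMap.smul_apply, map_smul, LinearMap.id_apply]
        · rw [Pi.single_eq_of_ne hij, if_neg hij, LinearMap.zero_apply, map_zero, smul_zero])
    refine ⟨v, fun x => ?_⟩
    have := LinearMap.congr_fun hv x
    by_cases hij : i = j
    · simpa [hij, Submonoid.smul_def] using this
    · simpa [hij, Submonoid.smul_def] using this
  choose v hv using key
  refine ⟨fun i => ((∏ k, v k : W) : R) • f (Fin.castLE hst i), fun j => g (Fin.castLE hst j),
    (∏ k, v k : W) * (u * u'), (W.mul_mem (∏ k, v k).2 (W.mul_mem hu hu')), fun i j => ?_⟩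
  ext x
  have h1 := congrArg (fun y => ((∏ k ∈ Finset.univ.erase (Fin.castLE hst i, Fin.castLE hst j),
    v k : W) : R) • y) (hv (Fin.castLE hst i, Fin.castLE hst j) x)
  simp only [← mul_smul, ← Submonoid.coe_mul,
    Finset.prod_erase_mul _ _ (Finset.mem_univ (Fin.castLE hst i, Fin.castLE hst j))] at h1
  change ((∏ k, v k : W) : R) • f (Fin.castLE hst i) (g (Fin.castLE hst j) x) = _
  rw [h1]
  by_cases hij : i = j
  · subst hij
    rw [if_pos rfl, if_pos rfl, LinearMap.smul_apply, LinearMap.id_apply, mul_smul _ (u * u')]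
  · rw [if_neg hij, if_neg fun h => hij (Fin.castLE_injective hst h), smul_zero,
      LinearMap.zero_apply]

end Localization

/-! ### Splittings in terms of submodules of free modules over `End N` -/

theorem support_end_subset {R T N : Type*} [CommRing R] [Ring T] [AddCommGroup N] [Module R N]
    [Module T N] [Module.Finite R N] [SMulCommClass T R N] :
    Module.support R (Module.End T N) ⊆ Module.support R N := by
  intro p hp
  by_contra h
  rw [Module.mem_support_iff_of_finite] at h
  obtain ⟨u, hu, hup⟩ := SetLike.not_le_iff_exists.1 h
  refine Module.notMem_support_iff'.2 (fun e => ⟨u, hup, ?_⟩) hp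
  ext x
  exact Module.mem_annihilator.1 hu _

section Global

variable {R T M N : Type*} [CommRing R] [Ring T] [Algebra R T]
  [AddCommGroup M] [Module R M] [Module T M] [IsScalarTower R T M]
  [AddCommGroup N] [Module R N] [Module T N] [IsScalarTower R T N]

/-- Evaluation at generators of `N` embeds the maps in a finite power of the Noetherian module `M`.
-/
theorem module_finite_linearMap [IsNoetherianRing R] [Module.Finite R M] [Module.Finite R N]
    [SMulCommClass T R M] : Module.Finite R (N →ₗ[T] M) := by
  obtain ⟨n, x, hx⟩ := Module.Finite.exists_fin (R := R) (M := N)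
  let ev : (N →ₗ[T] M) →ₗ[R] (Fin n → M) :=
    { toFun := fun f i => f (x i)
      map_add' := fun _ _ => rfl
      map_smul' := fun _ _ => rfl }
  refine Module.Finite.of_injective ev fun f g h => ?_
  have h1 : f.restrictScalars R = g.restrictScalars R :=
    LinearMap.ext_on_range hx fun i => congrFun h i
  exact LinearMap.ext fun y => LinearMap.congr_fun h1 y

/-- The submodule of `(End N) ^ n` of the tuples `(f ∘ g i)`, for `f` in `Hom(M, N)`. -/
def compTuples {n : ℕ} (g : Fin n → N →ₗ[T] M) :
    Submodule (Module.End T N) (Fin n → Module.End T N) where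
  carrier := Set.range fun (f : M →ₗ[T] N) i => f ∘ₗ g i
  add_mem' := by
    rintro _ _ ⟨f, rfl⟩ ⟨f', rfl⟩
    exact ⟨f + f', by ext; rfl⟩
  zero_mem' := ⟨0, by ext; rfl⟩
  smul_mem' := by
    rintro e _ ⟨f, rfl⟩
    exact ⟨e ∘ₗ f, by ext; rfl⟩

/-- Writing each `g' j` as an `R`-combination of the `g i` gives a matrix that sends `(f ∘ g i)` to
`(f ∘ g' j)`. With `f = ∑ y j ∘ f' j` the image is `w • y`, so the cokernel is killed by `w`. -/
theorem hasFibreRank_compTuples [IsNoetherianRing R] [Module.Finite R N] [SMulCommClass T R N]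
    [SMulCommClass T R M] [Module.Finite R (Module.End T N)] {n : ℕ}
    {g : Fin n → N →ₗ[T] M} (hg : Submodule.span R (Set.range g) = ⊤) {p : PrimeSpectrum R}
    {s : ℕ} (f' : Fin s → M →ₗ[T] N) (g' : Fin s → N →ₗ[T] M) {w : R} (hw : w ∉ p.asIdeal)
    (h : ∀ i j, f' i ∘ₗ g' j = if i = j then w • LinearMap.id else 0) :
    HasFibreRank p (compTuples g) s := by
  classical
  have hc : ∀ j, ∃ c : Fin n → R, ∑ i, c i • g i = g' j := fun j =>
    (Submodule.mem_span_range_iff_exists_fun R).1 (hg ▸ Submodule.mem_top)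
  choose c hc using hc
  refine HasFibreRank.of_notMem_support
    (Matrix.of fun i j => algebraMap R (Module.End T N) (c j i)) ?_
  refine Module.notMem_support_iff'.2 fun q => ⟨w, hw, ?_⟩
  obtain ⟨y, rfl⟩ := Submodule.mkQ_surjective _ q
  change w • ((Submodule.mkQ _).restrictScalars R) y = 0
  rw [← map_smul]
  refine (Submodule.Quotient.mk_eq_zero _).2 ?_
  refine ⟨_, ⟨∑ j, y j ∘ₗ f' j, rfl⟩, ?_⟩
  have h1 : ∀ k, (∑ j, y j ∘ₗ f' j) ∘ₗ g' k = w • y k := by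
    intro k
    ext x
    have h2 : ∀ j, f' j (g' k x) = if j = k then w • x else 0 := by
      intro j
      rw [← LinearMap.comp_apply, h]
      split_ifs <;> rfl
    have h3 : ∀ r : R, ∀ e : Module.End T N, e (r • x) = r • e x := fun r e =>
      (e.restrictScalars R).map_smul r x
    simp [h2, apply_ite, h3]
  ext k x
  have h4 : ∀ i (r : R), g i (r • x) = r • g i x := fun i r => (g i).map_smul_of_tower r x
  rw [Pi.smul_apply, ← h1, ← hc, Matrix.vecMulLinear_apply, Matrix.vecMul, dotProduct]
  simp only [Matrix.of_apply, LinearMap.sum_apply, LinearMap.comp_apply, map_sum,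
    Module.End.mul_apply, Module.algebraMap_end_apply, LinearMap.smul_apply, h4]

/-- `φ` is right multiplication by a matrix, so it turns `(f ∘ g i)` into `(f ∘ g' k)` for new maps
`g' k`. Preimages of the basis vectors are maps `f j` with `f j ∘ g' k` equal to the identity or
zero. -/
theorem exists_split_of_map_compTuples_eq_top {n t : ℕ} {g : Fin n → N →ₗ[T] M}
    (φ : (Fin n → Module.End T N) →ₗ[Module.End T N] (Fin t → Module.End T N))
    (hφ : (compTuples g).map φ = ⊤) :
    ∃ (f : M →ₗ[T] (Fin t → N)) (g' : (Fin t → N) →ₗ[T] M), f ∘ₗ g' = LinearMap.id := by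
  classical
  let g' : Fin t → N →ₗ[T] M := fun k => ∑ i, g i ∘ₗ φ (Pi.single i 1) k
  have hg' : ∀ (f : M →ₗ[T] N) k, φ (fun i => f ∘ₗ g i) k = f ∘ₗ g' k := by
    intro f k
    have h1 : (fun i => f ∘ₗ g i : Fin n → Module.End T N) =
        ∑ i, (f ∘ₗ g i : Module.End T N) • (Pi.single i 1 : Fin n → Module.End T N) := by
      ext1 j
      simp [Finset.sum_apply, Pi.single_apply]
    rw [h1, map_sum, Finset.sum_apply]
    ext x
    simp only [map_smul, Pi.smul_apply, smul_eq_mul, LinearMap.sum_apply, LinearMap.comp_apply,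
      Module.End.mul_apply, g', map_sum]
  have hf : ∀ j : Fin t, ∃ f : M →ₗ[T] N, ∀ k,
      f ∘ₗ g' k = (Pi.single j 1 : Fin t → Module.End T N) k := by
    intro j
    have h1 : (Pi.single j 1 : Fin t → Module.End T N) ∈ (compTuples g).map φ :=
      hφ ▸ Submodule.mem_top
    obtain ⟨_, ⟨f, rfl⟩, h⟩ := h1
    exact ⟨f, fun k => by rw [← h, hg']⟩
  choose f hf using hf
  refine ⟨LinearMap.pi f, ∑ k, g' k ∘ₗ LinearMap.proj k, ?_⟩
  ext1 k
  ext x j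
  have h1 : f j (g' k x) = (Pi.single j 1 : Fin t → Module.End T N) k x :=
    LinearMap.congr_fun (hf j k) x
  have h2 : (∑ l, g' l ∘ₗ LinearMap.proj l : (Fin t → N) →ₗ[T] M) (Pi.single k x) = g' k x := by
    rw [LinearMap.sum_apply, Finset.sum_eq_single k]
    · simp
    · intro l _ hl
      simp [Pi.single_eq_of_ne hl]
    · simp
  change f j ((∑ l, g' l ∘ₗ LinearMap.proj l : (Fin t → N) →ₗ[T] M) (Pi.single k x)) =
    (Pi.single k x : Fin t → N) j
  rw [h2, h1]
  by_cases hjk : j = k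
  · subst hjk
    simp
  · rw [Pi.single_eq_of_ne hjk, Pi.single_eq_of_ne (Ne.symm hjk), LinearMap.zero_apply]

end Global

/-! ### Assembly of the splitting theorem -/

/-- The core of the splitting theorem: `N ^ t` splits off from `M` if `(N_p) ^ (t + d p)` splits
off from `M_p` at all points `p` of `X`, for a function `d` that decreases along inclusions. -/
theorem exists_split_of_forall_le_localSplittingCapacity {R S M N : Type*} [CommRing R]
    [IsNoetherianRing R] [Ring S] [Algebra R S] [Module.Finite R S]
    [AddCommGroup M] [Module R M] [Module Sᵐᵒᵖ M] [IsScalarTower R Sᵐᵒᵖ M]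
    [Module.Finite Sᵐᵒᵖ M]
    [AddCommGroup N] [Module R N] [Module Sᵐᵒᵖ N] [IsScalarTower R Sᵐᵒᵖ N]
    [Module.Finite Sᵐᵒᵖ N] {X : Set (PrimeSpectrum R)} (hX : X = jSpec R ∩ Module.support R N)
    (d : PrimeSpectrum R → ℕ) (hd : ∀ p ∈ X, ∀ q ∈ X, q < p → d p < d q) (t : ℕ)
    (h : ∀ p ∈ X, ((t + d p : ℕ) : ℕ∞) ≤ localSplittingCapacity S M N p) :
    ∃ (f : M →ₗ[Sᵐᵒᵖ] (Fin t → N)) (g : (Fin t → N) →ₗ[Sᵐᵒᵖ] M), f ∘ₗ g = LinearMap.id := by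
  have : Module.Finite R M := Module.Finite.trans Sᵐᵒᵖ M
  have : Module.Finite R N := Module.Finite.trans Sᵐᵒᵖ N
  have : SMulCommClass R Sᵐᵒᵖ N := IsScalarTower.to_smulCommClass
  have : SMulCommClass Sᵐᵒᵖ R N := SMulCommClass.symm _ _ _
  have : SMulCommClass R Sᵐᵒᵖ M := IsScalarTower.to_smulCommClass
  have : SMulCommClass Sᵐᵒᵖ R M := SMulCommClass.symm _ _ _
  have : Module.Finite R (Module.End Sᵐᵒᵖ N) := module_finite_linearMap
  have : Module.Finite R (N →ₗ[Sᵐᵒᵖ] M) := module_finite_linearMap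
  obtain ⟨n, g, hg⟩ := Module.Finite.exists_fin (R := R) (M := N →ₗ[Sᵐᵒᵖ] M)
  -- Padding with zero maps ensures that there are at least `t` generators.
  let G : Fin (n + t) → N →ₗ[Sᵐᵒᵖ] M := Fin.append g 0
  have hG : Submodule.span R (Set.range G) = ⊤ := by
    rw [eq_top_iff, ← hg, Submodule.span_le]
    rintro _ ⟨i, rfl⟩
    exact Submodule.subset_span ⟨Fin.castAdd t i, Fin.append_left _ _ _⟩
  have hE : Module.support R (Module.End Sᵐᵒᵖ N) ⊆ Module.support R N := support_end_subset
  obtain ⟨φ, hφ⟩ := exists_linearMap_map_eq_top Module.isClosed_support hX hE d hd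
    (Nat.le_add_left t n) (compTuples G) fun p hp => by
      obtain ⟨f', g', w, hw, hfg⟩ := exists_comp_eq_smul_of_le_localSplittingCapacity (h p hp)
      exact (hasFibreRank_compTuples hG f' g' hw hfg).mono (min_le_right _ _)
  exact exists_split_of_map_compTuples_eq_top φ hφ

theorem theorem0p9 {R S M N : Type*} [CommRing R] [IsNoetherianRing R]
    [Ring S] [Algebra R S] [Module.Finite R S]
    [AddCommGroup M] [Module R M] [Module Sᵐᵒᵖ M] [IsScalarTower R Sᵐᵒᵖ M]
    [Module.Finite Sᵐᵒᵖ M]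
    [AddCommGroup N] [Module R N] [Module Sᵐᵒᵖ N] [IsScalarTower R Sᵐᵒᵖ N]
    [Module.Finite Sᵐᵒᵖ N]
    (X : Set (PrimeSpectrum R)) (hX : X = jSpec R ∩ Module.support R N)
    (hdim : topologicalKrullDim ↥X < ⊤) :
    (⨅ p ∈ X, (((localSplittingCapacity S M N p : ENNReal) : EReal) - dimToEReal (dimAt X p))) ≤
      ((splittingCapacity S M N : ENNReal) : EReal) := by
  classical
  have hex : ∀ p : PrimeSpectrum R, ∃ d : ℕ, p ∈ X → dimAt X p = ((d : ℕ∞) : WithBot ℕ∞) := by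
    intro p
    by_cases hp : p ∈ X
    · obtain ⟨d, hd⟩ := exists_nat_eq_dimAt hdim hp
      exact ⟨d, fun _ => hd⟩
    · exact ⟨0, fun h => absurd h hp⟩
  choose d hd using hex
  have hdlt : ∀ p ∈ X, ∀ q ∈ X, q < p → d p < d q := by
    intro p hp q hq hqp
    have h1 := dimAt_add_one_le hp hq hqp
    rw [hd p hp, hd q hq] at h1
    have h2 : ((d p + 1 : ℕ) : WithBot ℕ∞) ≤ (d q : ℕ) := by exact_mod_cast h1
    exact_mod_cast h2
  by_contra hlt
  rw [not_le] at hlt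
  rcases eq_or_ne (splittingCapacity S M N) ⊤ with htop | htop
  · rw [htop, ENat.toENNReal_top, EReal.coe_ennreal_top] at hlt
    exact not_top_lt hlt
  obtain ⟨n, hn⟩ := ENat.ne_top_iff_exists.1 htop
  rw [← hn] at hlt
  -- If the infimum exceeds a finite capacity `n`, every local capacity is at least `n + 1 + d p` by
  -- integrality, which would split off `N ^ (n + 1)`.
  have hloc : ∀ p ∈ X, ((n + 1 + d p : ℕ) : ℕ∞) ≤ localSplittingCapacity S M N p := by
    intro p hp
    have h1 := hlt.trans_le (iInf₂_le p hp)
    rw [hd p hp] at h1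
    rcases eq_or_ne (localSplittingCapacity S M N p) ⊤ with hl | hl
    · rw [hl]
      exact le_top
    · obtain ⟨m, hm⟩ := ENat.ne_top_iff_exists.1 hl
      rw [← hm] at h1 ⊢
      have h2 : ((n : ℝ) : EReal) < ((m : ℝ) : EReal) - ((d p : ℝ) : EReal) := by
        have hcast : ∀ k : ℕ, (((k : ℕ∞) : ENNReal) : EReal) = ((k : ℝ) : EReal) := fun k => by
          rw [ENat.toENNReal_coe, ← ENNReal.coe_natCast, EReal.coe_nnreal_eq_coe_real,
            NNReal.coe_natCast]
        rw [← hcast, ← hcast, ← hcast]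
        exact h1
      rw [← EReal.coe_sub, EReal.coe_lt_coe_iff, lt_sub_iff_add_lt] at h2
      have h3 : n + d p < m := by exact_mod_cast h2
      exact_mod_cast (by omega : n + 1 + d p ≤ m)
  have hsplit := exists_split_of_forall_le_localSplittingCapacity hX d hdlt (n + 1) hloc
  have h4 : ((n + 1 : ℕ) : ℕ∞) ≤ splittingCapacity S M N := le_sSup ⟨n + 1, rfl, hsplit⟩
  rw [← hn] at h4
  have h5 : n + 1 ≤ n := by exact_mod_cast h4
  omega
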